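/- Let $K$ be a field of characteristic different from $2$ and let $n\ge 1$. Let $M_n(K)^+$ be the special Jordan algebra of all $n\times n$ matrices over $K$ with the product $A\circ B=\tfrac12(AB+BA)$. For $A\in M_n(K)$ let $L_A\colon M_n(K)\to M_n(K)$, $L_A(X)=A\circ X$, and let $$\mathrm{JMS}(M_n(K)^+)=\langle L_A : A\in M_n(K)\rangle\subseteq \mathrm{End}_K(M_n(K))$$ be the semigroup generated under composition by all operators $L_A$; it is a monoid, since $L_{I_n}=\mathrm{id}$. Write $S^\times$ for the group of invertible elements of a monoid $S$, and $\mathrm{GL}(M_n(K))$ for the group of all invertible $K$-linear maps $M_n(K)\to M_n(K)$. Then $$\mathrm{JMS}(M_n(K)^+)^\times=\mathrm{GL}(M_n(K)).$$ -/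

import Mathlib

/-- The Jordan product `A ∘ B = (1/2)(AB + BA)` on the matrix algebra `M_n(K)`. -/
def jordanMul {K : Type*} [Field K] {n : ℕ} (A B : Matrix (Fin n) (Fin n) K) :
    Matrix (Fin n) (Fin n) K :=
  (2⁻¹ : K) • (A * B + B * A)

/-- The Jordan product is the product of Mathlib's symmetrized algebra. -/
theorem sym_jordanMul {K : Type*} [Field K] {n : ℕ} (h2 : ringChar K ≠ 2)
    [Invertible (2 : Matrix (Fin n) (Fin n) K)] (A B : Matrix (Fin n) (Fin n) K) :
    SymAlg.sym (jordanMul A B) = SymAlg.sym A * SymAlg.sym B := by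
  have h : (2 : K) ≠ 0 := Ring.two_ne_zero h2
  rw [SymAlg.mul_def, SymAlg.unsym_sym, SymAlg.unsym_sym]
  congr 1
  rw [eq_comm, invOf_mul_eq_iff_eq_mul_left, jordanMul, mul_smul_comm, two_mul, ← two_smul K,
    smul_smul, inv_mul_cancel₀ h, one_smul]

/-- The multiplication operator `L_A : X ↦ A ∘ X`, a `K`-linear endomorphism of `M_n(K)`. -/
def jordanL {K : Type*} [Field K] {n : ℕ} (A : Matrix (Fin n) (Fin n) K) :
    Module.End K (Matrix (Fin n) (Fin n) K) where
  toFun X := jordanMul A X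
  map_add' X Y := by
    simp only [jordanMul, mul_add, add_mul, ← smul_add]
    congr 1
    abel
  map_smul' c X := by
    simp only [jordanMul, mul_smul_comm, smul_mul_assoc, ← smul_add, RingHom.id_apply]
    rw [smul_comm]

/-- The Jordan multiplication semigroup of `M_n(K)^+`: the subsemigroup of `End_K(M_n(K))`
(under composition) generated by all multiplication operators `L_A`. -/
def JMS (K : Type*) [Field K] (n : ℕ) :
    Subsemigroup (Module.End K (Matrix (Fin n) (Fin n) K)) :=
  Subsemigroup.closure (Set.range jordanL)

/-- In characteristic different from `2`, `L_1` is the identity. -/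
theorem jordanL_one {K : Type*} [Field K] {n : ℕ} (h2 : ringChar K ≠ 2) :
    jordanL (1 : Matrix (Fin n) (Fin n) K) = 1 := by
  have h : (2 : K) ≠ 0 := Ring.two_ne_zero h2
  refine LinearMap.ext fun X => ?_
  change jordanMul 1 X = X
  rw [jordanMul, one_mul, mul_one, ← two_smul K, smul_smul, inv_mul_cancel₀ h, one_smul]

/-- The Jordan multiplication semigroup, regarded as a monoid (it contains the identity `L_1`
when the characteristic is not `2`). -/
def JMSMonoid (K : Type*) [Field K] (n : ℕ) (h2 : ringChar K ≠ 2) :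
    Submonoid (Module.End K (Matrix (Fin n) (Fin n) K)) where
  toSubsemigroup := JMS K n
  one_mem' := Subsemigroup.subset_closure ⟨1, jordanL_one h2⟩

/-- The unit group of the monoid `JMS(M_n(K)^+)` (the elements with a two-sided inverse inside the
monoid), realized inside the general linear group `GL(M_n(K))` along the inclusion
`JMS(M_n(K)^+) ⊆ End_K(M_n(K))`. -/
def JMSUnits (K : Type*) [Field K] (n : ℕ) (h2 : ringChar K ≠ 2) :
    Subgroup (LinearMap.GeneralLinearGroup K (Matrix (Fin n) (Fin n) K)) :=
  (Units.map (JMSMonoid K n h2).subtype).range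

/-! Let `S` be the Jordan multiplication monoid. It suffices that `S` contains every operator of
nonzero determinant, since the inverse then lies in `S` too. This follows from two facts: for n ≥ 2,
`S` contains all operators of determinant 1 (`mem_JMSMonoid_of_det_eq_one`), and the determinants of
elements of `S` fill K^× (`mem_jordanDet`). For n = 1 all operators are scalars and the second fact
is enough.

Determinant 1: for E = E_ij with i ≠ j, the map N : Z ↦ EZ + ZE satisfies 1 + tN = L_{1+2tE} and N²
= 2a with a of rank one, so (1 + tN)(1 - tN) = 1 - 2t²a is a transvection in `S`. The opposite sign
comes from repetition in characteristic p, and from conjugation by a Peirce operator in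
characteristic 0; differences of squares then give every coefficient. Weyl elements, conjugation by
1 + E_ji and commutators carry this to all pairs of matrix units (`containsTransvections_single`).

Determinants: L_A for A = diag(a,1,…,1) has determinant a((a+1)/2)^(2(n-1)). These values generate
K^× when K has more than three elements (`Submonoid.mem_of_prod_formula`); over F_3 a symmetric
matrix with eigenvalues in F_9 supplies -1. -/

section RankOne

/-! ### Transvections in a monoid of endomorphisms. -/

variable {K V : Type*} [Field K] [AddCommGroup V] [Module K V]

/-- The rank one operator `x ↦ φ x • v`. -/
def rankOne (v : V) (φ : V →ₗ[K] K) : Module.End K V := φ.smulRight v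

@[simp]
theorem rankOne_apply (v : V) (φ : V →ₗ[K] K) (x : V) : rankOne v φ x = φ x • v := rfl

theorem rankOne_mul_rankOne (v w : V) (φ ψ : V →ₗ[K] K) :
    rankOne v φ * rankOne w ψ = φ w • rankOne v ψ := by
  ext x
  simp [smul_smul, mul_comm]

theorem mul_rankOne (f : Module.End K V) (v : V) (φ : V →ₗ[K] K) :
    f * rankOne v φ = rankOne (f v) φ := by
  ext x
  simp

theorem rankOne_mul (f : Module.End K V) (v : V) (φ : V →ₗ[K] K) :
    rankOne v φ * f = rankOne v (φ ∘ₗ f) := rfl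

theorem rankOne_zero_left (φ : V →ₗ[K] K) : rankOne 0 φ = 0 := by
  ext x
  simp

theorem rankOne_zero_right (v : V) : rankOne v (0 : V →ₗ[K] K) = 0 := by
  ext x
  simp

theorem rankOne_add_left (v w : V) (φ : V →ₗ[K] K) :
    rankOne (v + w) φ = rankOne v φ + rankOne w φ := by
  ext x
  simp

theorem rankOne_add_right (v : V) (φ ψ : V →ₗ[K] K) :
    rankOne v (φ + ψ) = rankOne v φ + rankOne v ψ := by
  ext x
  simp [add_smul]

theorem rankOne_smul_left (c : K) (v : V) (φ : V →ₗ[K] K) :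
    rankOne (c • v) φ = c • rankOne v φ := by
  ext x
  simp [smul_smul, mul_comm]

theorem rankOne_smul_right (c : K) (v : V) (φ : V →ₗ[K] K) :
    rankOne v (c • φ) = c • rankOne v φ := by
  ext x
  simp [smul_smul]

variable (S : Submonoid (Module.End K V))

/-- The submonoid `S` contains all the operators `1 + c • rankOne v φ`. -/
def ContainsTransvections (v : V) (φ : V →ₗ[K] K) : Prop :=
  ∀ c : K, 1 + c • rankOne v φ ∈ S

variable {S}

namespace ContainsTransvections

theorem add_left {v w : V} {φ : V →ₗ[K] K} (hv : ContainsTransvections S v φ)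
    (hw : ContainsTransvections S w φ) (h : φ w = 0) : ContainsTransvections S (v + w) φ := by
  intro c
  convert S.mul_mem (hv c) (hw c) using 1
  simp only [mul_add, add_mul, mul_one, one_mul, smul_mul_assoc, mul_smul_comm,
    rankOne_mul_rankOne, h, rankOne_add_left]
  module

theorem add_right {v : V} {φ ψ : V →ₗ[K] K} (hφ : ContainsTransvections S v φ)
    (hψ : ContainsTransvections S v ψ) (h : φ v = 0) : ContainsTransvections S v (φ + ψ) := by
  intro c
  convert S.mul_mem (hφ c) (hψ c) using 1
  simp only [mul_add, add_mul, mul_one, one_mul, smul_mul_assoc, mul_smul_comm,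
    rankOne_mul_rankOne, h, rankOne_add_right]
  module

theorem smul_left {v : V} {φ : V →ₗ[K] K} (h : ContainsTransvections S v φ) (k : K) :
    ContainsTransvections S (k • v) φ := by
  intro c
  convert h (c * k) using 1
  rw [rankOne_smul_left, smul_smul]

theorem smul_right {v : V} {φ : V →ₗ[K] K} (h : ContainsTransvections S v φ) (k : K) :
    ContainsTransvections S v (k • φ) := by
  intro c
  convert h (c * k) using 1
  rw [rankOne_smul_right, smul_smul]

/-- Put X = (c / φ w) • `rankOne v φ` and Y = `rankOne w ψ`. Then X² = Y² = YX = 0, so the group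
commutator of 1 + X and 1 + Y is 1 + XY. -/
theorem commutator {v w : V} {φ ψ : V →ₗ[K] K} (hv : ContainsTransvections S v φ)
    (hw : ContainsTransvections S w ψ) (h₁ : φ v = 0) (h₂ : ψ w = 0) (h₃ : ψ v = 0)
    (h₄ : φ w ≠ 0) : ContainsTransvections S v ψ := by
  intro c
  convert S.mul_mem (S.mul_mem (hv (c / φ w)) (hw 1)) (S.mul_mem (hv (-(c / φ w))) (hw (-1)))
    using 1
  simp only [mul_add, add_mul, mul_one, one_mul, smul_mul_assoc, mul_smul_comm,
    rankOne_mul_rankOne, h₁, h₂, h₃, smul_smul]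
  match_scalars <;> field_simp <;> ring

theorem conj {v : V} {φ : V →ₗ[K] K} (h : ContainsTransvections S v φ) {f g : Module.End K V}
    (hfg : f * g = 1) (hS : ∀ x ∈ S, f * x * g ∈ S) :
    ContainsTransvections S (f v) (φ ∘ₗ g) := by
  intro c
  convert hS _ (h c) using 1
  simp only [mul_add, add_mul, mul_one, hfg, smul_mul_assoc, mul_smul_comm, mul_rankOne,
    rankOne_mul]

/-- If `1 + t • N ∈ S` for all `t` and `N ^ 2` is twice a rank one operator, then `S` contains the
transvections with coefficient `-2 * t ^ 2`. -/
theorem neg_sq_mem {N : Module.End K V} {e : V} {φ : V →ₗ[K] K}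
    (hN : ∀ t : K, 1 + t • N ∈ S) (hNN : N * N = (2 : K) • rankOne e φ) (t : K) :
    1 + (-2 * t ^ 2) • rankOne e φ ∈ S := by
  convert S.mul_mem (hN t) (hN (-t)) using 1
  simp only [mul_add, add_mul, mul_one, one_mul, smul_mul_assoc, mul_smul_comm, hNN]
  module

theorem add_mem {e : V} {φ : V →ₗ[K] K} (he : φ e = 0) {c d : K}
    (hc : 1 + c • rankOne e φ ∈ S) (hd : 1 + d • rankOne e φ ∈ S) :
    1 + (c + d) • rankOne e φ ∈ S := by
  convert S.mul_mem hc hd using 1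
  simp only [mul_add, add_mul, mul_one, one_mul, smul_mul_assoc, mul_smul_comm,
    rankOne_mul_rankOne, he]
  module

theorem nsmul_mem {e : V} {φ : V →ₗ[K] K} (he : φ e = 0) {c : K}
    (hc : 1 + c • rankOne e φ ∈ S) (m : ℕ) : 1 + ((m : K) * c) • rankOne e φ ∈ S := by
  induction m with
  | zero => simp
  | succ m ih =>
    convert add_mem he ih hc using 3
    push_cast
    ring

theorem of_neg_sq_of_sq (h2 : (2 : K) ≠ 0) {e : V} {φ : V →ₗ[K] K} (he : φ e = 0)
    (hneg : ∀ t : K, 1 + (-2 * t ^ 2) • rankOne e φ ∈ S)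
    (hpos : ∀ t : K, 1 + (2 * t ^ 2) • rankOne e φ ∈ S) : ContainsTransvections S e φ := by
  intro c
  -- With u = -c/2 the two coefficients add up to ((u - 1)² - (u + 1)²)/2 = -2u = c.
  convert add_mem he (hneg ((-c / 2 + 1) / 2)) (hpos ((-c / 2 - 1) / 2)) using 3
  field_simp
  ring

/-- In characteristic p, adding -2t² to itself p - 1 times gives 2t². -/
theorem of_charP (h2 : (2 : K) ≠ 0) (p : ℕ) [CharP K p] (hp : p ≠ 0) {N : Module.End K V}
    {e : V} {φ : V →ₗ[K] K} (he : φ e = 0) (hN : ∀ t : K, 1 + t • N ∈ S)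
    (hNN : N * N = (2 : K) • rankOne e φ) : ContainsTransvections S e φ := by
  refine of_neg_sq_of_sq h2 he (neg_sq_mem hN hNN) fun t => ?_
  convert nsmul_mem he (neg_sq_mem hN hNN t) (p - 1) using 3
  rw [Nat.cast_sub (Nat.one_le_iff_ne_zero.mpr hp), CharP.cast_eq_zero]
  push_cast
  ring

/-- The positive sign comes from conjugating N by 1 + q, whose inverse is 1 - q/2. The conjugates in
the two directions, N₁ and N₂, satisfy N₁ + N₂ = (5/2)N and N₁N₂ = 8a, where a is the rank one
operator. -/
theorem of_charZero [CharZero K] {N q : Module.End K V} {e : V} {φ : V →ₗ[K] K}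
    (he : φ e = 0) (hN : ∀ t : K, 1 + t • N ∈ S) (hNN : N * N = (2 : K) • rankOne e φ)
    (hNe : N e = 0) (hφN : φ ∘ₗ N = 0) (hφq : φ ∘ₗ q = φ)
    (hqN : q * N = N - N * q) (hqq : q * q = q) (hq₁ : 1 + q ∈ S)
    (hq₂ : 1 - (2⁻¹ : K) • q ∈ S) : ContainsTransvections S e φ := by
  set a := rankOne e φ with ha
  set Y := N * q with hY
  have hqY : q * Y = 0 := by
    rw [hY, ← mul_assoc, hqN, sub_mul, hY, mul_assoc, hqq, sub_self]
  have hYq : Y * q = Y := by rw [hY, mul_assoc, hqq]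
  have hYY : Y * Y = 0 := by rw [hY, mul_assoc, ← hY, hqY, mul_zero]
  have hNY : N * Y = (2 : K) • a := by
    rw [hY, ← mul_assoc, hNN, smul_mul_assoc, rankOne_mul, hφq]
  have hYN : Y * N = 0 := by
    rw [hY, mul_assoc, hqN, mul_sub, hNY, hNN, sub_self]
  have hNa : N * a = 0 := by rw [ha, mul_rankOne, hNe, rankOne_zero_left]
  have haN : a * N = 0 := by rw [ha, rankOne_mul, hφN, rankOne_zero_right]
  have haa : a * a = 0 := by rw [ha, rankOne_mul_rankOne, he, zero_smul]
  have h₁ : ∀ t : K, 1 + t • ((2 : K) • N - (3 / 2 : K) • Y) ∈ S := fun t => by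
    convert S.mul_mem (S.mul_mem hq₁ (hN t)) hq₂ using 1
    simp only [mul_add, add_mul, mul_sub, sub_mul, mul_one, one_mul, smul_mul_assoc,
      mul_smul_comm, hqN, hYq, hqq, ← hY]
    module
  have h₂ : ∀ t : K, 1 + t • ((2⁻¹ : K) • N + (3 / 2 : K) • Y) ∈ S := fun t => by
    convert S.mul_mem (S.mul_mem hq₂ (hN t)) hq₁ using 1
    simp only [mul_add, add_mul, sub_mul, mul_one, one_mul, smul_mul_assoc,
      mul_smul_comm, hqN, hYq, hqq, ← hY]
    module
  have h₃ : ∀ t : K, 1 + (7 / 2 * t ^ 2) • a ∈ S := fun t => by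
    have h₁₂ : ∀ t : K, 1 + t • ((5 / 2 : K) • N) + (8 * t ^ 2) • a ∈ S := fun t => by
      convert S.mul_mem (h₁ t) (h₂ t) using 1
      simp only [mul_add, add_mul, sub_mul, mul_one, one_mul, smul_mul_assoc,
        mul_smul_comm, hNN, hNY, hYN, hYY, smul_add, smul_sub, smul_zero]
      module
    -- The linear terms cancel, leaving the coefficient 2·8 - 2·(5/2)² = 7/2.
    convert S.mul_mem (h₁₂ t) (h₁₂ (-t)) using 1
    simp only [mul_add, add_mul, mul_one, one_mul, smul_mul_assoc, mul_smul_comm, hNN, hNa, haN,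
      haa]
    module
  refine of_neg_sq_of_sq two_ne_zero he (neg_sq_mem hN hNN) fun t => ?_
  -- 7 · (7/2)(2t/7)² = 2t².
  convert nsmul_mem he (h₃ (2 * t / 7)) 7 using 3
  push_cast
  ring

/-- The square of the Weyl element attached to a pair of opposite transvections. -/
theorem one_sub_two_mem {e f : V} {φ ψ : V →ₗ[K] K} (hφ : ContainsTransvections S e φ)
    (hψ : ContainsTransvections S f ψ) (hφe : φ e = 0) (hφf : φ f = 1) (hψe : ψ e = 1)
    (hψf : ψ f = 0) : 1 - (2 : K) • (rankOne e ψ + rankOne f φ) ∈ S := by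
  -- This Weyl element swaps e and f up to sign, so its square is -1 on their span and 1 on ker φ ∩
  -- ker ψ.
  have hw := S.mul_mem (S.mul_mem (hφ 1) (hψ (-1))) (hφ 1)
  convert S.mul_mem hw hw using 1
  simp only [mul_add, add_mul, mul_one, one_mul, smul_mul_assoc, mul_smul_comm,
    rankOne_mul_rankOne, hφe, hφf, hψe, hψf]
  module

/-- Splitting off the part of `N` that is visible on the plane spanned by `e` and `f`. -/
theorem one_add_smul_mem (h2 : (2 : K) ≠ 0) {N : Module.End K V} {e f u : V}
    {φ ψ σ : V →ₗ[K] K} (hN : ∀ t : K, 1 + t • N ∈ S) (hNN : N * N = (2 : K) • rankOne e φ)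
    (hφ : ContainsTransvections S e φ) (hψ : ContainsTransvections S f ψ)
    (hφe : φ e = 0) (hφf : φ f = 1) (hψe : ψ e = 1) (hψf : ψ f = 0)
    (hNe : N e = 0) (hNf : N f = u) (hφN : φ ∘ₗ N = 0) (hψN : ψ ∘ₗ N = σ) (hσf : σ f = 0)
    (t : K) : 1 + t • (rankOne e σ + rankOne u φ) ∈ S := by
  have hs := one_sub_two_mem hφ hψ hφe hφf hψe hψf
  have hφu : φ u = 0 := by rw [← hNf]; exact LinearMap.congr_fun hφN f
  have hψu : ψ u = 0 := by rw [← hNf, ← hσf, ← hψN]; rfl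
  have hσe : σ e = 0 := by simp [← hψN, hNe]
  have hNu : N u = (2 : K) • e := by
    have h := LinearMap.congr_fun hNN f
    simpa [hNf, hφf] using h
  -- The involution s isolates A = `rankOne e σ + rankOne u φ` as the part of N that anticommutes
  -- with it: sNs = N - 2A. Hence (1 + (t/2)N)(1 - (t/2)sNs) is 1 + tA up to a multiple of `rankOne
  -- e φ`, which a transvection removes.
  set s := 1 - (2 : K) • (rankOne e ψ + rankOne f φ) with hs_def
  have hss : s * s = 1 := by
    simp only [hs_def, mul_add, mul_sub, add_mul, sub_mul, mul_one, one_mul, smul_mul_assoc,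
      mul_smul_comm, rankOne_mul_rankOne, hφe, hφf, hψe, hψf]
    module
  have hsN : s * N = N - (2 : K) • rankOne e σ := by
    simp only [hs_def, add_mul, sub_mul, one_mul, smul_mul_assoc, rankOne_mul, hφN, hψN,
      rankOne_zero_right, add_zero]
  have hsNs : s * N * s = N - (2 : K) • (rankOne e σ + rankOne u φ) := by
    rw [hsN]
    simp only [hs_def, mul_add, mul_sub, sub_mul, mul_one, smul_mul_assoc, mul_smul_comm,
      mul_rankOne, rankOne_apply, hNe, hNf, hσe, hσf, zero_smul, rankOne_zero_left]
    module
  have h₁ : ∀ c : K, 1 + c • (N - (2 : K) • (rankOne e σ + rankOne u φ)) ∈ S := fun c => by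
    convert S.mul_mem (S.mul_mem hs (hN c)) hs using 1
    rw [mul_add, add_mul, mul_one, hss, mul_smul_comm, smul_mul_assoc, hsNs]
  have hNA : N * (rankOne e σ + rankOne u φ) = (2 : K) • rankOne e φ := by
    rw [mul_add, mul_rankOne, mul_rankOne, hNe, hNu, rankOne_zero_left, rankOne_smul_left, zero_add]
  have hNa : N * rankOne e φ = 0 := by rw [mul_rankOne, hNe, rankOne_zero_left]
  have hAa : (rankOne e σ + rankOne u φ) * rankOne e φ = 0 := by
    rw [add_mul, rankOne_mul_rankOne, rankOne_mul_rankOne, hσe, hφe, zero_smul, zero_smul,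
      add_zero]
  have haa : rankOne e φ * rankOne e φ = 0 := by rw [rankOne_mul_rankOne, hφe, zero_smul]
  generalize rankOne e σ + rankOne u φ = A at *
  have h₂ : 1 + t • A + (2 * (t / 2) ^ 2) • rankOne e φ ∈ S := by
    convert S.mul_mem (hN (t / 2)) (h₁ (-(t / 2))) using 1
    simp only [mul_add, add_mul, mul_sub, mul_one, one_mul, smul_mul_assoc, mul_smul_comm,
      hNN, hNA]
    match_scalars <;> field_simp <;> ring
  convert S.mul_mem h₂ (hφ (-2 * (t / 2) ^ 2)) using 1
  simp only [mul_add, add_mul, mul_one, one_mul, smul_mul_assoc, mul_smul_comm, hAa, haa]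
  module

/-- Two opposite nilpotent operators `N` and `N'` yield the transvections that they are built
from. -/
theorem pair_of_opposite (h2 : (2 : K) ≠ 0) {N N' : Module.End K V} {e f u : V}
    {φ ψ σ : V →ₗ[K] K} (hN : ∀ t : K, 1 + t • N ∈ S) (hN' : ∀ t : K, 1 + t • N' ∈ S)
    (hNN : N * N = (2 : K) • rankOne e φ) (hNN' : N' * N' = (2 : K) • rankOne f ψ)
    (hφ : ContainsTransvections S e φ) (hψ : ContainsTransvections S f ψ)
    (hφe : φ e = 0) (hφf : φ f = 1) (hψe : ψ e = 1) (hψf : ψ f = 0)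
    (hNe : N e = 0) (hNf : N f = u) (hφN : φ ∘ₗ N = 0) (hψN : ψ ∘ₗ N = σ)
    (hNe' : N' f = 0) (hNf' : N' e = u) (hφN' : ψ ∘ₗ N' = 0) (hψN' : φ ∘ₗ N' = σ) :
    ContainsTransvections S e σ ∧ ContainsTransvections S u φ := by
  have hσe : σ e = 0 := by simp [← hψN, hNe]
  have hσf : σ f = 0 := by simp [← hψN', hNe']
  have hφu : φ u = 0 := by rw [← hNf]; exact LinearMap.congr_fun hφN f
  have hψu : ψ u = 0 := by rw [← hNf']; exact LinearMap.congr_fun hφN' e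
  have hσu : σ u = 2 := by
    have h := LinearMap.congr_fun hNN f
    have h' : ψ (N (N f)) = 2 := by
      rw [← Module.End.mul_apply, h]; simp [hφf, hψe]
    rw [← h', hNf, ← hψN]; rfl
  have h₁ := one_add_smul_mem h2 hN hNN hφ hψ hφe hφf hψe hψf hNe hNf hφN hψN hσf
  have h₂ := one_add_smul_mem h2 hN' hNN' hψ hφ hψf hψe hφf hφe hNe' hNf' hφN' hψN' hσe
  -- w is the Weyl element f ↦ e, e ↦ -f, with inverse w'. Conjugating the operators obtained from
  -- N' by w turns the sum in `h₁` into the difference `rankOne e σ - rankOne u φ`; the two together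
  -- separate the summands.
  set w := 1 - rankOne e ψ - rankOne f φ + rankOne e φ - rankOne f ψ with hw_def
  set w' := 1 - rankOne e ψ - rankOne f φ - rankOne e φ + rankOne f ψ with hw_def'
  have hw : w ∈ S := by
    convert S.mul_mem (S.mul_mem (hφ 1) (hψ (-1))) (hφ 1) using 1
    simp only [hw_def, mul_add, add_mul, mul_one, one_mul, smul_mul_assoc, mul_smul_comm,
      rankOne_mul_rankOne, hφe, hφf, hψe]
    module
  have hw' : w' ∈ S := by
    convert S.mul_mem (S.mul_mem (hφ (-1)) (hψ 1)) (hφ (-1)) using 1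
    simp only [hw_def', mul_add, add_mul, mul_one, one_mul, smul_mul_assoc, mul_smul_comm,
      rankOne_mul_rankOne, hφe, hφf, hψe]
    module
  have hww : w * w' = 1 := by
    simp only [hw_def, hw_def', mul_add, add_mul, mul_sub, sub_mul, mul_one, one_mul,
      rankOne_mul_rankOne, hφe, hφf, hψe, hψf]
    module
  have h₄ : w * (rankOne f σ + rankOne u ψ) = rankOne e σ + rankOne u ψ := by
    simp only [hw_def, mul_add, add_mul, sub_mul, one_mul,
      rankOne_mul_rankOne, hφf, hψf, hφu, hψu]
    module
  have h₅ : (rankOne e σ + rankOne u ψ) * w' = rankOne e σ - rankOne u φ := by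
    simp only [hw_def', mul_add, add_mul, mul_sub, mul_one,
      rankOne_mul_rankOne, hψe, hψf, hσe, hσf]
    module
  clear_value w w'
  have h₃ : ∀ t : K, 1 + t • (rankOne e σ - rankOne u φ) ∈ S := fun t => by
    convert S.mul_mem (S.mul_mem hw (h₂ t)) hw' using 1
    rw [mul_add, add_mul, mul_one, hww, mul_smul_comm, smul_mul_assoc, h₄, h₅]
  have hXX : rankOne e σ * rankOne e σ = 0 := by rw [rankOne_mul_rankOne, hσe, zero_smul]
  have hXY : rankOne e σ * rankOne u φ = (2 : K) • rankOne e φ := by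
    rw [rankOne_mul_rankOne, hσu]
  have hYX : rankOne u φ * rankOne e σ = 0 := by rw [rankOne_mul_rankOne, hφe, zero_smul]
  have hYY : rankOne u φ * rankOne u φ = 0 := by rw [rankOne_mul_rankOne, hφu, zero_smul]
  have hXa : rankOne e σ * rankOne e φ = 0 := by rw [rankOne_mul_rankOne, hσe, zero_smul]
  have hYa : rankOne u φ * rankOne e φ = 0 := by rw [rankOne_mul_rankOne, hφe, zero_smul]
  have haa : rankOne e φ * rankOne e φ = 0 := by rw [rankOne_mul_rankOne, hφe, zero_smul]
  constructor
  · intro c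
    convert S.mul_mem (S.mul_mem (h₁ (c / 2)) (h₃ (c / 2))) (hφ (2 * (c / 2) ^ 2)) using 1
    simp only [mul_add, add_mul, mul_sub, mul_one, one_mul, smul_mul_assoc, mul_smul_comm,
      hXX, hXY, hYX, hYY, hXa, hYa, haa, sub_mul, zero_mul, smul_zero]
    match_scalars <;> field_simp <;> ring
  · intro c
    convert S.mul_mem (S.mul_mem (h₁ (c / 2)) (h₃ (-(c / 2)))) (hφ (-2 * (c / 2) ^ 2)) using 1
    simp only [mul_add, add_mul, mul_sub, mul_one, one_mul, smul_mul_assoc, mul_smul_comm,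
      hXX, hXY, hYX, hYY, hXa, hYa, haa, sub_mul, zero_mul, smul_zero]
    match_scalars <;> field_simp <;> ring

end ContainsTransvections

end RankOne

/-! ### Transvections between matrix units in the Jordan multiplication monoid. -/

section JordanOperators

open LinearMap

variable {K : Type*} [Field K] {n : ℕ}

theorem jordanL_mem (h2 : ringChar K ≠ 2) (A : Matrix (Fin n) (Fin n) K) :
    jordanL A ∈ JMSMonoid K n h2 :=
  Subsemigroup.subset_closure ⟨A, rfl⟩

theorem jordanL_apply (A X : Matrix (Fin n) (Fin n) K) :
    jordanL A X = (2⁻¹ : K) • (A * X + X * A) := rfl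

/-- Conjugation by an invertible matrix preserves the Jordan multiplication semigroup. -/
theorem conj_mem_JMSMonoid (h2 : ringChar K ≠ 2) {P Q : Matrix (Fin n) (Fin n) K}
    (hQP : Q * P = 1) {x : Module.End K (Matrix (Fin n) (Fin n) K)}
    (hx : x ∈ JMSMonoid K n h2) :
    (mulLeft K P * mulRight K Q) * x * (mulLeft K Q * mulRight K P) ∈ JMSMonoid K n h2 := by
  have hQP' : ∀ Z, Q * (P * Z) = Z := fun Z => by rw [← mul_assoc, hQP, one_mul]
  have hinv : (mulLeft K Q * mulRight K P) * (mulLeft K P * mulRight K Q) = 1 := by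
    ext1 Z
    simp [mul_assoc, hQP, hQP']
  change x ∈ Subsemigroup.closure _ at hx
  induction hx using Subsemigroup.closure_induction with
  | mem x hx =>
    obtain ⟨A, rfl⟩ := hx
    convert jordanL_mem h2 (P * A * Q) using 1
    have hPQ' : ∀ Z, P * (Q * Z) = Z := fun Z => by
      rw [← mul_assoc, mul_eq_one_comm.mp hQP, one_mul]
    refine LinearMap.ext fun Z => ?_
    simp [jordanL_apply, mul_add, add_mul, mul_assoc, mul_eq_one_comm.mp hQP, hPQ']
  | mul x y _ _ hx hy =>
    generalize mulLeft K P * mulRight K Q = g at *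
    generalize mulLeft K Q * mulRight K P = g' at *
    convert (JMSMonoid K n h2).mul_mem hx hy using 1
    calc g * (x * y) * g' = g * x * (g' * g) * y * g' := by rw [hinv]; simp only [mul_assoc, one_mul]
      _ = g * x * g' * (g * y * g') := by simp only [mul_assoc]

/-- The coordinate functional `Z ↦ Z k l`. -/
abbrev coord (k l : Fin n) : Matrix (Fin n) (Fin n) K →ₗ[K] K := Matrix.entryLinearMap K K k l

/-- The operator `Z ↦ E Z + Z E` of a matrix unit `E = E_kl`. -/
def unitOp (k l : Fin n) : Module.End K (Matrix (Fin n) (Fin n) K) :=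
  mulLeft K (Matrix.single k l 1) + mulRight K (Matrix.single k l 1)

theorem unitOp_apply (k l : Fin n) (Z : Matrix (Fin n) (Fin n) K) :
    unitOp k l Z = Matrix.single k l 1 * Z + Z * Matrix.single k l 1 := rfl

theorem one_add_smul_unitOp_mem (h2 : ringChar K ≠ 2) (k l : Fin n) (t : K) :
    1 + t • unitOp k l ∈ JMSMonoid K n h2 := by
  have h : (2 : K) ≠ 0 := Ring.two_ne_zero h2
  convert jordanL_mem h2 (1 + (2 * t) • Matrix.single k l (1 : K)) using 1
  refine LinearMap.ext fun Z => ?_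
  simp only [jordanL_apply, LinearMap.add_apply, LinearMap.smul_apply, Module.End.one_apply,
    unitOp_apply, add_mul, mul_add, one_mul, mul_one, smul_mul_assoc, mul_smul_comm]
  match_scalars <;> field_simp
  norm_num

theorem unitOp_mul_self {i j : Fin n} (hij : i ≠ j) :
    unitOp i j * unitOp i j = (2 : K) • rankOne (Matrix.single i j (1 : K)) (coord j i) := by
  refine LinearMap.ext fun Z => ?_
  have h : Matrix.single i j (1 : K) * Matrix.single i j 1 = 0 :=
    Matrix.single_mul_single_of_ne _ _ _ _ hij.symm _
  have h' : Matrix.single i j (1 : K) * Z * Matrix.single i j 1 = Z j i • Matrix.single i j 1 := by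
    rw [Matrix.single_mul_mul_single]
    simp
  simp only [Module.End.mul_apply, unitOp_apply, mul_add, add_mul, ← mul_assoc, h, h', zero_mul]
  rw [mul_assoc, h, mul_zero]
  simp only [LinearMap.smul_apply, rankOne_apply, Matrix.entryLinearMap_apply]
  module

/-- The projection onto the half-space of the Peirce decomposition of the idempotent `E_ii`. -/
def peirceHalf (i : Fin n) : Module.End K (Matrix (Fin n) (Fin n) K) :=
  mulLeft K (Matrix.single i i 1) + mulRight K (Matrix.single i i 1) -
    (2 : K) • (mulLeft K (Matrix.single i i 1) * mulRight K (Matrix.single i i 1))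

theorem peirceHalf_apply (i : Fin n) (Z : Matrix (Fin n) (Fin n) K) :
    peirceHalf i Z = Matrix.single i i 1 * Z + Z * Matrix.single i i 1 -
      (2 : K) • (Matrix.single i i 1 * (Z * Matrix.single i i 1)) := rfl

theorem peirceHalf_mul_self (i : Fin n) :
    peirceHalf i * peirceHalf i = (peirceHalf i : Module.End K (Matrix (Fin n) (Fin n) K)) := by
  refine LinearMap.ext fun Z => ?_
  simp only [Module.End.mul_apply, peirceHalf_apply]
  have h : Matrix.single i i (1 : K) * Matrix.single i i 1 = Matrix.single i i 1 := by simp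
  generalize Matrix.single i i (1 : K) = p at *
  have h' : ∀ X, p * (p * X) = p * X := fun X => by rw [← mul_assoc, h]
  simp only [mul_add, add_mul, mul_sub, sub_mul, mul_smul_comm, smul_mul_assoc, mul_assoc, h, h']
  module

theorem peirceHalf_mul_unitOp {i j : Fin n} (hij : i ≠ j) :
    peirceHalf i * unitOp i j = (unitOp i j - unitOp i j * peirceHalf i :
      Module.End K (Matrix (Fin n) (Fin n) K)) := by
  refine LinearMap.ext fun Z => ?_
  simp only [Module.End.mul_apply, LinearMap.sub_apply, peirceHalf_apply, unitOp_apply]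
  have h₁ : Matrix.single i i (1 : K) * Matrix.single i j 1 = Matrix.single i j 1 := by simp
  have h₂ : Matrix.single i j (1 : K) * Matrix.single i i 1 = 0 :=
    Matrix.single_mul_single_of_ne _ _ _ _ hij.symm _
  generalize Matrix.single i i (1 : K) = p at *
  generalize Matrix.single i j (1 : K) = e at *
  have h₁' : ∀ X, p * (e * X) = e * X := fun X => by rw [← mul_assoc, h₁]
  have h₂' : ∀ X, e * (p * X) = 0 := fun X => by rw [← mul_assoc, h₂, zero_mul]
  simp only [mul_add, add_mul, mul_sub, sub_mul, mul_smul_comm, smul_mul_assoc, mul_assoc,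
    h₁, h₁', h₂, h₂', mul_zero]
  module

/-- For A = 1 + (s - 1)E_ii, L_A acts on the Peirce spaces of E_ii by s, (s + 1)/2 and 1.
Multiplying by the operator for s⁻¹ leaves (s + 1)²/(4s) on the half-space and 1 elsewhere. -/
theorem one_add_smul_peirceHalf_mem (h2 : ringChar K ≠ 2) (i : Fin n) {s : K} (hs : s ≠ 0) :
    1 + ((s - 1) ^ 2 / (4 * s)) • peirceHalf i ∈ JMSMonoid K n h2 := by
  have h : (2 : K) ≠ 0 := Ring.two_ne_zero h2
  have h4 : (4 : K) ≠ 0 := by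
    rw [show (4 : K) = 2 * 2 by norm_num]
    exact mul_ne_zero h h
  convert (JMSMonoid K n h2).mul_mem (jordanL_mem h2 (1 + (s - 1) • Matrix.single i i (1 : K)))
    (jordanL_mem h2 (1 + (s⁻¹ - 1) • Matrix.single i i (1 : K))) using 1
  refine LinearMap.ext fun Z => ?_
  simp only [Module.End.mul_apply, LinearMap.add_apply, LinearMap.smul_apply, peirceHalf_apply,
    jordanL_apply, Module.End.one_apply]
  have h : Matrix.single i i (1 : K) * Matrix.single i i 1 = Matrix.single i i 1 := by simp
  generalize Matrix.single i i (1 : K) = p at *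
  have h' : ∀ X, p * (p * X) = p * X := fun X => by rw [← mul_assoc, h]
  simp only [mul_add, add_mul, mul_smul_comm, smul_mul_assoc, mul_assoc, h, h', one_mul, mul_one]
  match_scalars <;> field_simp <;> ring

theorem one_add_add_smul_peirceHalf_mem {S : Submonoid (Module.End K (Matrix (Fin n) (Fin n) K))}
    {i : Fin n} {x y : K} (hx : 1 + x • peirceHalf i ∈ S) (hy : 1 + y • peirceHalf i ∈ S) :
    1 + (x + y + x * y) • peirceHalf i ∈ S := by
  convert S.mul_mem hx hy using 1
  simp only [mul_add, add_mul, mul_one, one_mul, smul_mul_assoc, mul_smul_comm,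
    peirceHalf_mul_self]
  module

theorem one_add_peirceHalf_mem [CharZero K] (h2 : ringChar K ≠ 2) (i : Fin n) :
    1 + peirceHalf i ∈ JMSMonoid K n h2 := by
  have h₃ := one_add_smul_peirceHalf_mem h2 i (s := 3) (by norm_num)
  have h₂ := one_add_smul_peirceHalf_mem h2 i (s := 2) (by norm_num)
  -- On the half-space: (4/3)² · 9/8 = 2.
  have h := one_add_add_smul_peirceHalf_mem (one_add_add_smul_peirceHalf_mem h₃ h₃) h₂
  norm_num at h
  exact h

theorem one_sub_peirceHalf_mem [CharZero K] (h2 : ringChar K ≠ 2) (i : Fin n) :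
    1 - (2⁻¹ : K) • peirceHalf i ∈ JMSMonoid K n h2 := by
  have h₃ := one_add_smul_peirceHalf_mem h2 i (s := -3) (by norm_num)
  have h₂ := one_add_smul_peirceHalf_mem h2 i (s := 2) (by norm_num)
  have h₁ : 1 + (1 : K) • peirceHalf i ∈ JMSMonoid K n h2 := by
    rw [one_smul]
    exact one_add_peirceHalf_mem h2 i
  -- On the half-space: (-1/3)² · 9/8 · 2² = 1/2.
  convert one_add_add_smul_peirceHalf_mem (one_add_add_smul_peirceHalf_mem
    (one_add_add_smul_peirceHalf_mem h₃ h₃) h₂) (one_add_add_smul_peirceHalf_mem h₁ h₁) using 1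
  rw [sub_eq_add_neg]
  congr 1
  match_scalars
  norm_num

theorem unitOp_single_self {i j : Fin n} (hij : i ≠ j) :
    unitOp i j (Matrix.single i j (1 : K)) = 0 := by
  rw [unitOp_apply, Matrix.single_mul_single_of_ne _ _ _ _ hij.symm, add_zero]

theorem unitOp_single_swap (i j : Fin n) :
    unitOp i j (Matrix.single j i (1 : K)) = Matrix.single i i 1 + Matrix.single j j 1 := by
  simp [unitOp_apply]

theorem coord_swap_comp_unitOp {i j : Fin n} (hij : i ≠ j) :
    coord j i ∘ₗ unitOp i j = (0 : Matrix (Fin n) (Fin n) K →ₗ[K] K) := by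
  refine LinearMap.ext fun Z => ?_
  simp [unitOp_apply, hij, hij.symm]

theorem coord_comp_unitOp (i j : Fin n) :
    coord i j ∘ₗ unitOp i j = (coord i i + coord j j : Matrix (Fin n) (Fin n) K →ₗ[K] K) := by
  refine LinearMap.ext fun Z => ?_
  simp [unitOp_apply, add_comm]

theorem coord_single (i j k l : Fin n) (c : K) :
    coord i j (Matrix.single k l c) = if k = i ∧ l = j then c else 0 := rfl

theorem containsTransvections_single_swap (h2 : ringChar K ≠ 2) {i j : Fin n} (hij : i ≠ j) :
    ContainsTransvections (JMSMonoid K n h2) (Matrix.single i j 1) (coord j i) := by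
  have h : (2 : K) ≠ 0 := Ring.two_ne_zero h2
  have he : coord j i (Matrix.single i j (1 : K)) = 0 := by simp [hij]
  by_cases hp : ringChar K = 0
  · have : CharP K 0 := hp ▸ ringChar.charP K
    have : CharZero K := CharP.charP_to_charZero K
    refine ContainsTransvections.of_charZero he (one_add_smul_unitOp_mem h2 i j)
      (unitOp_mul_self hij) (unitOp_single_self hij) (coord_swap_comp_unitOp hij) ?_
      (peirceHalf_mul_unitOp hij) (peirceHalf_mul_self i) (one_add_peirceHalf_mem h2 i)
      (one_sub_peirceHalf_mem h2 i)
    refine LinearMap.ext fun Z => ?_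
    simp [peirceHalf_apply, hij.symm]
  · exact ContainsTransvections.of_charP h (ringChar K) hp he (one_add_smul_unitOp_mem h2 i j)
      (unitOp_mul_self hij)

theorem containsTransvections_diag (h2 : ringChar K ≠ 2) {i j : Fin n} (hij : i ≠ j) :
    ContainsTransvections (JMSMonoid K n h2) (Matrix.single i j 1) (coord i i + coord j j) ∧
    ContainsTransvections (JMSMonoid K n h2) (Matrix.single i i 1 + Matrix.single j j 1)
      (coord j i) := by
  refine ContainsTransvections.pair_of_opposite (Ring.two_ne_zero h2)
    (one_add_smul_unitOp_mem h2 i j) (one_add_smul_unitOp_mem h2 j i)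
    (unitOp_mul_self hij) (unitOp_mul_self hij.symm)
    (containsTransvections_single_swap h2 hij) (containsTransvections_single_swap h2 hij.symm)
    ?_ ?_ ?_ ?_ (unitOp_single_self hij) (unitOp_single_swap i j) (coord_swap_comp_unitOp hij)
    (coord_comp_unitOp i j) (unitOp_single_self hij.symm) ?_ (coord_swap_comp_unitOp hij.symm) ?_
  · simp [hij]
  · simp
  · simp
  · simp [hij.symm]
  · rw [unitOp_single_swap, add_comm]
  · rw [coord_comp_unitOp, add_comm]

/-- Conjugation by 1 + E_ji fixes E_ii + E_jj and the functional Z_ii + Z_jj but moves E_ij and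
Z_ji. Removing the known terms from the images leaves E_jj - E_ii and Z_jj - Z_ii. Commutators pair
these with Z_ji and E_ij, and half sums and differences isolate the single entries. -/
theorem containsTransvections_adjacent (h2 : ringChar K ≠ 2) {i j : Fin n} (hij : i ≠ j) :
    ContainsTransvections (JMSMonoid K n h2) (Matrix.single i j 1) (coord i i) ∧
    ContainsTransvections (JMSMonoid K n h2) (Matrix.single i j 1) (coord j j) ∧
    ContainsTransvections (JMSMonoid K n h2) (Matrix.single i i 1) (coord j i) ∧
    ContainsTransvections (JMSMonoid K n h2) (Matrix.single j j 1) (coord j i) := by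
  have h : (2 : K) ≠ 0 := Ring.two_ne_zero h2
  obtain ⟨h₁, h₂⟩ := containsTransvections_diag h2 hij
  obtain ⟨h₃, h₄⟩ := containsTransvections_diag h2 hij.symm
  rw [add_comm] at h₃ h₄
  have hff : Matrix.single j i (1 : K) * Matrix.single j i 1 = 0 :=
    Matrix.single_mul_single_of_ne _ _ _ _ hij _
  have hPQ : (1 + Matrix.single j i 1) * (1 - Matrix.single j i (1 : K)) = 1 := by
    rw [add_mul, mul_sub, mul_sub, hff]
    simp
  have hQP := mul_eq_one_comm.mp hPQ
  have hconj : (mulLeft K (1 + Matrix.single j i (1 : K)) *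
      mulRight K (1 - Matrix.single j i (1 : K))) *
      (mulLeft K (1 - Matrix.single j i (1 : K)) *
      mulRight K (1 + Matrix.single j i (1 : K))) = 1 := by
    refine LinearMap.ext fun Z => ?_
    simp only [Module.End.mul_apply, mulLeft_apply, mulRight_apply, Module.End.one_apply]
    rw [mul_assoc _ _ (1 - _), mul_assoc Z, hPQ, mul_one, ← mul_assoc, hPQ, one_mul]
  set g := mulLeft K (1 + Matrix.single j i (1 : K)) * mulRight K (1 - Matrix.single j i (1 : K))
    with hg
  set g' := mulLeft K (1 - Matrix.single j i (1 : K)) * mulRight K (1 + Matrix.single j i (1 : K))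
    with hg'
  have hge : g (Matrix.single i j 1) = Matrix.single i j 1 + Matrix.single j j 1 -
      Matrix.single i i 1 - Matrix.single j i 1 := by
    simp [hg, add_mul, mul_sub]
    abel
  have hgu : g (Matrix.single i i 1 + Matrix.single j j 1) =
      Matrix.single i i 1 + Matrix.single j j 1 := by
    simp [hg, mul_add, add_mul, mul_sub, hij]
    abel
  have hσg : (coord i i + coord j j) ∘ₗ g' = coord i i + coord j j := by
    refine LinearMap.ext fun Z => ?_
    simp [hg', mul_add, sub_mul, hij, hij.symm]
  have hφg : coord j i ∘ₗ g' = coord j i - coord i i + coord j j - coord i j := by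
    refine LinearMap.ext fun Z => ?_
    simp [hg', mul_add, sub_mul]
    ring
  have h₅ : ContainsTransvections (JMSMonoid K n h2)
      (Matrix.single j j 1 - Matrix.single i i 1) (coord i i + coord j j) := by
    have hc := h₁.conj hconj fun x hx => conj_mem_JMSMonoid h2 hQP hx
    rw [hge, hσg] at hc
    convert (hc.add_left (h₁.smul_left (-1)) ?_).add_left h₃ ?_ using 1
    · module
    · simp [hij, hij.symm]
    · simp [hij, hij.symm]
  have h₆ : ContainsTransvections (JMSMonoid K n h2)
      (Matrix.single i i 1 + Matrix.single j j 1) (coord j j - coord i i) := by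
    have hc := h₂.conj hconj fun x hx => conj_mem_JMSMonoid h2 hQP hx
    rw [hgu, hφg] at hc
    convert (hc.add_right (h₂.smul_right (-1)) ?_).add_right h₄ ?_ using 1
    · module
    · simp [hij, hij.symm]
    · simp [hij, hij.symm]
  have h₇ : ContainsTransvections (JMSMonoid K n h2) (Matrix.single i j 1)
      (coord j j - coord i i) := by
    refine h₁.commutator h₆ ?_ ?_ ?_ ?_ <;> simp [hij, hij.symm, one_add_one_eq_two, h]
  have h₈ : ContainsTransvections (JMSMonoid K n h2)
      (Matrix.single j j 1 - Matrix.single i i 1) (coord j i) := by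
    refine h₅.commutator h₂ ?_ ?_ ?_ ?_ <;> simp [hij, hij.symm, one_add_one_eq_two, h]
  refine ⟨?_, ?_, ?_, ?_⟩
  · convert (h₁.smul_right 2⁻¹).add_right (h₇.smul_right (-2⁻¹)) ?_ using 1
    · match_scalars <;> field_simp <;> norm_num
    · simp [hij, hij.symm]
  · convert (h₁.smul_right 2⁻¹).add_right (h₇.smul_right 2⁻¹) ?_ using 1
    · match_scalars <;> field_simp <;> norm_num
    · simp [hij, hij.symm]
  · convert (h₂.smul_left 2⁻¹).add_left (h₈.smul_left (-2⁻¹)) ?_ using 1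
    · match_scalars <;> field_simp <;> norm_num
    · simp [hij, hij.symm]
  · convert (h₂.smul_left 2⁻¹).add_left (h₈.smul_left 2⁻¹) ?_ using 1
    · match_scalars <;> field_simp <;> norm_num
    · simp [hij, hij.symm]

/-- A commutator composes two links. The hypotheses are conditional so that a chain may contain
repeated positions. -/
theorem containsTransvections_trans (h2 : ringChar K ≠ 2) {a b c : Fin n × Fin n}
    (hab : a ≠ b → ContainsTransvections (JMSMonoid K n h2) (Matrix.single a.1 a.2 1)
      (coord b.1 b.2))
    (hbc : b ≠ c → ContainsTransvections (JMSMonoid K n h2) (Matrix.single b.1 b.2 1)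
      (coord c.1 c.2)) (hac : a ≠ c) :
    ContainsTransvections (JMSMonoid K n h2) (Matrix.single a.1 a.2 1) (coord c.1 c.2) := by
  by_cases h₁ : a = b
  · subst h₁; exact hbc hac
  by_cases h₂ : b = c
  · subst h₂; exact hab hac
  have key : ∀ x y : Fin n × Fin n, x ≠ y → coord y.1 y.2 (Matrix.single x.1 x.2 (1 : K)) = 0 :=
    fun x y hxy => by
      rw [coord_single, if_neg fun h => hxy (Prod.ext h.1 h.2)]
  exact (hab h₁).commutator (hbc h₂) (key _ _ h₁) (key _ _ h₂) (key _ _ hac)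
    (by simp)

theorem containsTransvections_single (h2 : ringChar K ≠ 2) (a b : Fin n × Fin n) (hab : a ≠ b) :
    ContainsTransvections (JMSMonoid K n h2) (Matrix.single a.1 a.2 1) (coord b.1 b.2) := by
  have h₁ : ∀ i j, (i, j) ≠ (i, i) → ContainsTransvections (JMSMonoid K n h2)
      (Matrix.single i j 1) (coord i i) := fun i j hij =>
    (containsTransvections_adjacent h2 (by rintro rfl; exact hij rfl)).1
  have h₂ : ∀ i j, (i, i) ≠ (i, j) → ContainsTransvections (JMSMonoid K n h2)
      (Matrix.single i i 1) (coord i j) := fun i j hij =>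
    (containsTransvections_adjacent h2 (i := j) (by rintro rfl; exact hij rfl)).2.2.2
  have h₃ : ∀ i j, (i, j) ≠ (j, j) → ContainsTransvections (JMSMonoid K n h2)
      (Matrix.single i j 1) (coord j j) := fun i j hij =>
    (containsTransvections_adjacent h2 (by rintro rfl; exact hij rfl)).2.1
  obtain ⟨i, j⟩ := a
  obtain ⟨k, l⟩ := b
  -- The chain is (i,j), (i,i), (i,k), (k,k), (k,l), alternately entering and leaving the diagonal.
  exact containsTransvections_trans h2 (b := (i, i)) (h₁ i j)
    (containsTransvections_trans h2 (b := (i, k)) (h₂ i k)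
      (containsTransvections_trans h2 (b := (k, k)) (h₃ i k) (h₂ k l))) hab

end JordanOperators

/-! ### Generating K^× from the determinants of diagonal matrices. -/

section ScalarLemma

variable {K : Type*} [Field K]

/-- The aim is to invert ((a + 1)/2)^(2m) inside Δ and so strip it from the given element. Since Δ
is only a monoid, inverses must be produced by explicit identities. -/
theorem Submonoid.mem_of_prod_formula (Δ : Submonoid K) (h2 : (2 : K) ≠ 0) (m : ℕ)
    (hΔ : ∀ a : K, a * ((a + 1) / 2) ^ (2 * m) ∈ Δ) {b : K} (hb : b ≠ 0) (hb₁ : b ≠ 1)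
    (hb₂ : b ≠ -1) {d : K} (hd : d ≠ 0) : d ∈ Δ := by
  have h4 : (4 : K) ≠ 0 := by
    rw [show (4 : K) = 2 * 2 by norm_num]
    exact mul_ne_zero h2 h2
  have h64 : (64 : K) ≠ 0 := by
    rw [show (64 : K) = 4 * 4 * 4 by norm_num]
    exact mul_ne_zero (mul_ne_zero h4 h4) h4
  have hf : ∀ s : K, s ≠ 0 → ((s + 1) ^ 2 / (4 * s)) ^ (2 * m) ∈ Δ := fun s hs => by
    convert Δ.mul_mem (hΔ s) (hΔ s⁻¹) using 1
    rw [mul_mul_mul_comm, mul_inv_cancel₀ hs, one_mul, ← mul_pow]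
    congr 1
    field_simp
    ring
  -- If x + y + z = 0, then (z²/xy)(y²/xz)(x²/yz) = 1. Here s = y/x, and each factor carries an
  -- extra 1/4.
  have hprod : ∀ s : K, s ≠ 0 → s ≠ -1 →
      ((s + 1) ^ 2 / (4 * s)) * ((-(s + 1) + 1) ^ 2 / (4 * -(s + 1))) *
        ((-s / (s + 1) + 1) ^ 2 / (4 * (-s / (s + 1)))) = 64⁻¹ := fun s hs hs' => by
    have : s + 1 ≠ 0 := fun h => hs' (eq_neg_of_add_eq_zero_left h)
    field_simp
    ring
  have h64inv : (64⁻¹ : K) ^ (2 * m) ∈ Δ := by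
    have : b + 1 ≠ 0 := fun h => hb₂ (eq_neg_of_add_eq_zero_left h)
    rw [← hprod b hb hb₂, mul_pow, mul_pow]
    exact Δ.mul_mem (Δ.mul_mem (hf _ hb) (hf _ (neg_ne_zero.mpr this)))
      (hf _ (div_ne_zero (neg_ne_zero.mpr hb) this))
  have h64mem : (64 : K) ^ (2 * m) ∈ Δ := by
    by_cases hp : ringChar K = 0
    · have : CharP K 0 := hp ▸ ringChar.charP K
      have : CharZero K := CharP.charP_to_charZero K
      -- (4/3)² · 9/8 = 2, and 2⁶ = 64.
      have h := Δ.mul_mem (Δ.mul_mem (hf 3 (by norm_num)) (hf 3 (by norm_num))) (hf 2 h2)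
      rw [← mul_pow, ← mul_pow] at h
      convert Δ.pow_mem h 6 using 1
      rw [← pow_mul, mul_comm _ 6, pow_mul _ 6]
      congr 1
      norm_num
    · obtain ⟨p, hpK⟩ := CharP.exists K
      have hp0 : p ≠ 0 := fun h => hp (by rw [ringChar.eq K p, h])
      have hpp : p.Prime := (CharP.char_is_prime_or_zero K p).resolve_right hp0
      have : Fact p.Prime := ⟨hpp⟩
      have h64p : (64 : K) ^ p = 64 := map_ofNat (frobenius K p) 64
      -- 64 lies in the prime field, so 64^(p-1) = 1.
      have : (64⁻¹ : K) ^ (p - 2) = 64 := by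
        obtain ⟨k, rfl⟩ := Nat.exists_eq_add_of_le hpp.two_le
        rw [Nat.add_sub_cancel_left, inv_pow, inv_eq_iff_eq_inv]
        refine eq_inv_of_mul_eq_one_left ?_
        rw [add_comm, pow_add, pow_two, ← mul_assoc] at h64p
        exact mul_right_cancel₀ h64 (h64p.trans (one_mul _).symm)
      convert Δ.pow_mem h64inv (p - 2) using 1
      rw [← pow_mul, mul_comm (2 * m), pow_mul _ (p - 2), this]
  -- For nonzero arguments `G` describes the units of Δ.
  let G : K → Prop := fun x => x ∈ Δ ∧ x⁻¹ ∈ Δ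
  have hmul : ∀ {x y}, G x → G y → G (x * y) := fun hx hy =>
    ⟨Δ.mul_mem hx.1 hy.1, by rw [mul_inv]; exact Δ.mul_mem hx.2 hy.2⟩
  have hinv : ∀ {x}, G x → G x⁻¹ := fun hx => ⟨hx.2, by rw [inv_inv]; exact hx.1⟩
  have hdiv : ∀ {x y}, G x → G y → G (x / y) := fun hx hy => by
    rw [div_eq_mul_inv]
    exact hmul hx (hinv hy)
  have hone : G 1 := ⟨Δ.one_mem, by rw [inv_one]; exact Δ.one_mem⟩
  have hGf : ∀ s : K, s ≠ 0 → s ≠ -1 → G (((s + 1) ^ 2 / (4 * s)) ^ (2 * m)) := fun s hs hs' => by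
    refine ⟨hf s hs, ?_⟩
    have hs₁ : s + 1 ≠ 0 := fun h => hs' (eq_neg_of_add_eq_zero_left h)
    convert Δ.mul_mem (Δ.mul_mem h64mem (hf _ (neg_ne_zero.mpr hs₁)))
      (hf _ (div_ne_zero (neg_ne_zero.mpr hs) hs₁)) using 1
    rw [← mul_pow, ← mul_pow, ← inv_pow]
    congr 1
    have h := hprod s hs hs'
    rw [mul_assoc] at h
    refine inv_eq_of_mul_eq_one_right ?_
    rw [mul_assoc, mul_left_comm, h, mul_inv_cancel₀ h64]
  have hGsq : ∀ v : K, v ≠ 0 → G ((v ^ 2) ^ (2 * m)) := fun v hv => by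
    by_cases hv₁ : v = 1
    · simpa [hv₁] using hone
    by_cases hv₂ : v = -1
    · simpa [hv₂] using hone
    have hv₁' : v - 1 ≠ 0 := sub_ne_zero.mpr hv₁
    have hv₂' : v + 1 ≠ 0 := fun h => hv₂ (eq_neg_of_add_eq_zero_left h)
    have hs : (v - 1) / (v + 1) ≠ 0 := div_ne_zero hv₁' hv₂'
    have e₁ : (v - 1) / (v + 1) + 1 = 2 * v / (v + 1) := by field_simp; ring
    have e₂ : -((v - 1) / (v + 1)) + 1 = 2 / (v + 1) := by field_simp; ring
    have g₁ := hGf _ hs fun h => by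
      rw [h, neg_add_cancel, eq_comm] at e₁
      exact div_ne_zero (mul_ne_zero h2 hv) hv₂' e₁
    have g₂ := hGf _ (neg_ne_zero.mpr hs) fun h => by
      rw [h, neg_add_cancel, eq_comm] at e₂
      exact div_ne_zero h2 hv₂' e₂
    -- For s = (v - 1)/(v + 1), the quotient of (s + 1)²/(4s) by its value at -s is -v²; the even
    -- exponent removes the sign.
    convert hdiv g₁ g₂ using 1
    rw [← div_pow, e₁, e₂, pow_mul, pow_mul]
    congr 1
    field_simp
  have hGpow : ∀ a : K, a ≠ 0 → G (a ^ (2 * m)) := fun a ha => by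
    by_cases ha' : a = -1
    · rw [ha', pow_mul, neg_one_sq, one_pow]
      exact hone
    have ha₁ : a + 1 ≠ 0 := fun h => ha' (eq_neg_of_add_eq_zero_left h)
    -- a = (a + 1)² / (2² · (a + 1)²/(4a)).
    convert hdiv (hGsq _ ha₁) (hmul (hGsq _ h2) (hGf a ha ha')) using 1
    rw [← mul_pow, ← div_pow]
    congr 1
    field_simp
    norm_num
  have hG : ∀ a : K, a ≠ 0 → a ≠ -1 → a ∈ Δ := fun a ha ha' => by
    have ha₁ : a + 1 ≠ 0 := fun h => ha' (eq_neg_of_add_eq_zero_left h)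
    have h := Δ.mul_mem (hΔ a) (hGpow _ (div_ne_zero ha₁ h2)).2
    rwa [mul_assoc, mul_inv_cancel₀ (pow_ne_zero _ (div_ne_zero ha₁ h2)), mul_one] at h
  by_cases hd' : d = -1
  · have h := Δ.mul_mem (hG (-b) (neg_ne_zero.mpr hb) fun h => hb₁ (neg_injective h))
      (hG b⁻¹ (inv_ne_zero hb) fun h => hb₂ (by rw [inv_eq_iff_eq_inv] at h; simpa using h))
    rwa [neg_mul, mul_inv_cancel₀ hb, ← hd'] at h
  · exact hG d hd hd'

end ScalarLemma

/-! ### Determinants of Jordan multiplication operators. -/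

section JordanDet

open Matrix Kronecker

variable {K : Type*} [Field K]

/-- The matrix of the Jordan multiplication operator in the basis of matrix units. -/
def jordanKronecker {ι : Type*} [Fintype ι] [DecidableEq ι] (A : Matrix ι ι K) :
    Matrix (ι × ι) (ι × ι) K :=
  (2⁻¹ : K) • (A ⊗ₖ (1 : Matrix ι ι K) + (1 : Matrix ι ι K) ⊗ₖ Aᵀ)

theorem toMatrix_jordanL {n : ℕ} (A : Matrix (Fin n) (Fin n) K) :
    LinearMap.toMatrix (Matrix.stdBasis K (Fin n) (Fin n)) (Matrix.stdBasis K (Fin n) (Fin n))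
      (jordanL A) = jordanKronecker A := by
  ext ⟨i, j⟩ ⟨k, l⟩
  rw [LinearMap.toMatrix_apply, Matrix.stdBasis_eq_single, jordanL_apply]
  have h : ∀ Z : Matrix (Fin n) (Fin n) K,
      (Matrix.stdBasis K (Fin n) (Fin n)).repr Z (i, j) = Z i j := fun Z => rfl
  rw [h]
  simp only [jordanKronecker, Matrix.smul_apply, Matrix.add_apply, Matrix.kroneckerMap_apply,
    Matrix.transpose_apply, Matrix.mul_apply, Matrix.single_apply, Matrix.one_apply]
  congr 2
  · by_cases hj : l = j
    · simp [hj]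
    · simp [hj, Ne.symm hj]
  · by_cases hi : k = i
    · simp [hi]
    · simp [hi, Ne.symm hi]

theorem det_jordanL_reindex {ι : Type*} [Fintype ι] [DecidableEq ι] {n : ℕ} (e : ι ≃ Fin n)
    (A : Matrix ι ι K) : LinearMap.det (jordanL (reindex e e A)) = (jordanKronecker A).det := by
  rw [← LinearMap.det_toMatrix (Matrix.stdBasis K (Fin n) (Fin n)), toMatrix_jordanL,
    ← Matrix.det_reindex_self (e.prodCongr e) (jordanKronecker A)]
  congr 1
  ext ⟨i, j⟩ ⟨k, l⟩
  simp [jordanKronecker, Matrix.one_apply, mul_add]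

/-- Symmetry of A lets the same P diagonalise A and Aᵀ, so P ⊗ P diagonalises the Kronecker sum,
with eigenvalues (d_i + d_j)/2. -/
theorem algebraMap_det_jordanKronecker {L : Type*} [Field L] [Algebra K L] {ι : Type*} [Fintype ι]
    [DecidableEq ι] {A : Matrix ι ι K} (hA : Aᵀ = A) {P : Matrix ι ι L} (hP : P.det ≠ 0)
    {d : ι → L} (hPd : A.map (algebraMap K L) * P = P * diagonal d) :
    algebraMap K L (jordanKronecker A).det = ∏ i, ∏ j, (d i + d j) / 2 := by
  have hmap : (jordanKronecker A).map (algebraMap K L) =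
      jordanKronecker (A.map (algebraMap K L)) := by
    ext ⟨i, j⟩ ⟨k, l⟩
    simp [jordanKronecker, Matrix.one_apply, apply_ite (algebraMap K L), mul_add,
      map_ofNat (algebraMap K L) 2]
  have hA' : (A.map (algebraMap K L))ᵀ = A.map (algebraMap K L) := by
    rw [← Matrix.transpose_map, hA]
  have hconj : jordanKronecker (A.map (algebraMap K L)) * (P ⊗ₖ P) =
      (P ⊗ₖ P) * jordanKronecker (diagonal d) := by
    simp only [jordanKronecker, hA', diagonal_transpose, smul_mul_assoc, mul_smul_comm, add_mul,
      mul_add, ← mul_kronecker_mul, hPd, one_mul, mul_one]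
  have hdiag : jordanKronecker (diagonal d) =
      diagonal fun p : ι × ι => (d p.1 + d p.2) / 2 := by
    ext ⟨i, j⟩ ⟨k, l⟩
    by_cases hi : i = k <;> by_cases hj : j = l <;>
      simp [jordanKronecker, hi, hj, div_eq_inv_mul]
  have hPP : (P ⊗ₖ P).det ≠ 0 := by
    rw [Matrix.det_kronecker]
    exact mul_ne_zero (pow_ne_zero _ hP) (pow_ne_zero _ hP)
  have h := congrArg Matrix.det hconj
  rw [det_mul, det_mul, mul_comm] at h
  rw [RingHom.map_det, RingHom.mapMatrix_apply, hmap, mul_left_cancel₀ hPP h, hdiag, det_diagonal,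
    Fintype.prod_prod_type]

/-- The determinants of the elements of the Jordan multiplication semigroup. -/
noncomputable def jordanDet (K : Type*) [Field K] (n : ℕ) (h2 : ringChar K ≠ 2) : Submonoid K :=
  (JMSMonoid K n h2).map LinearMap.det

theorem det_jordanKronecker_mem {n : ℕ} (h2 : ringChar K ≠ 2) {ι : Type*} [Fintype ι]
    [DecidableEq ι] (hι : Fintype.card ι = n) (A : Matrix ι ι K) :
    (jordanKronecker A).det ∈ jordanDet K n h2 :=
  ⟨_, jordanL_mem h2 _, det_jordanL_reindex (Fintype.equivFinOfCardEq hι) A⟩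

theorem prod_formula_mem_jordanDet {n : ℕ} (h2 : ringChar K ≠ 2) (a : K) :
    a * ((a + 1) / 2) ^ (2 * n) ∈ jordanDet K (n + 1) h2 := by
  have h : (2 : K) ≠ 0 := Ring.two_ne_zero h2
  convert det_jordanKronecker_mem h2 (n := n + 1) (ι := Unit ⊕ Fin n) (by simp [add_comm])
    (diagonal (Sum.elim (fun _ => a) fun _ => 1)) using 1
  have := algebraMap_det_jordanKronecker (L := K)
    (A := diagonal (Sum.elim (fun _ : Unit => a) fun _ : Fin n => (1 : K))) (P := 1)
    (diagonal_transpose _) (by simp) (d := Sum.elim (fun _ => a) fun _ => 1)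
    (by simp)
  rw [Algebra.algebraMap_self_apply] at this
  rw [this]
  simp only [Fintype.prod_sum_type, Sum.elim_inl, Sum.elim_inr, Finset.prod_const,
    Finset.card_univ, Fintype.card_unit, Fintype.card_fin, div_self h, one_pow,
    mul_one, pow_one, add_comm (1 : K) a, ← two_mul]
  rw [mul_div_cancel_left₀ _ h]
  ring

/-- Over F_3 a diagonal matrix with both entries 1 and -1 gives a singular operator, hence the 2 × 2
block with characteristic polynomial x² - x - 1 = (x + 1)² + 1. The block contributes det · (tr/2)²
= -1, and all other factors multiply to 1. -/
theorem neg_one_mem_jordanDet {n : ℕ} (h2 : ringChar K ≠ 2) (h3 : (3 : K) = 0) :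
    -1 ∈ jordanDet K (n + 2) h2 := by
  let L := AlgebraicClosure K
  have h3L : (3 : L) = 0 := by
    rw [← map_ofNat (algebraMap K L) 3, ← map_zero (algebraMap K L)]
    exact congrArg _ h3
  obtain ⟨i, hi⟩ := IsAlgClosed.exists_pow_nat_eq (-1 : L) (n := 2) two_pos
  have hi0 : i ≠ 0 := by
    rintro rfl
    norm_num at hi
  let A : Matrix (Fin 2 ⊕ Fin n) (Fin 2 ⊕ Fin n) K := fromBlocks !![0, 1; 1, 1] 0 0 1
  let d : Fin 2 ⊕ Fin n → L := Sum.elim ![-1 + i, -1 - i] fun _ => 1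
  let P : Matrix (Fin 2 ⊕ Fin n) (Fin 2 ⊕ Fin n) L := fromBlocks !![1, 1; -1 + i, -1 - i] 0 0 1
  have hA : Aᵀ = A := by
    rw [fromBlocks_transpose]
    congr 1
    · ext k l
      fin_cases k <;> fin_cases l <;> rfl
    · simp
  have hP : P.det ≠ 0 := by
    have : P.det = i := by
      rw [det_fromBlocks_zero₂₁, det_fin_two_of, det_one]
      linear_combination -i * h3L
    rwa [this]
  have hPd : A.map (algebraMap K L) * P = P * diagonal d := by
    have hd : diagonal d = fromBlocks !![-1 + i, 0; 0, -1 - i] 0 0 1 := by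
      have : !![-1 + i, 0; 0, -1 - i] = diagonal ![-1 + i, -1 - i] := by
        ext k l
        fin_cases k <;> fin_cases l <;> rfl
      rw [this, ← diagonal_one, fromBlocks_diagonal]
    have hAm : A.map (algebraMap K L) = fromBlocks !![0, 1; 1, 1] 0 0 1 := by
      rw [fromBlocks_map]
      congr 1
      · ext k l
        fin_cases k <;> fin_cases l <;> simp
      · simp
      · simp
      · simp
    rw [hd, hAm, fromBlocks_multiply, fromBlocks_multiply]
    congr 1
    · ext k l
      fin_cases k <;> fin_cases l <;> simp
      · linear_combination -hi + i * h3L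
      · linear_combination -hi - i * h3L
    · simp
    · simp
  have h := algebraMap_det_jordanKronecker hA hP hPd
  convert det_jordanKronecker_mem h2 (n := n + 2) (ι := Fin 2 ⊕ Fin n) (by simp [add_comm]) A using 1
  apply (algebraMap K L).injective
  rw [h, map_neg, map_one]
  have h2L : (2 : L)⁻¹ = -1 := by
    rw [inv_eq_iff_eq_inv, inv_neg, inv_one]
    linear_combination h3L
  simp only [div_eq_mul_inv, h2L, Fintype.prod_sum_type, Fin.prod_univ_two, d, Sum.elim_inl, Sum.elim_inr,
    Finset.prod_const, Finset.card_univ, Fintype.card_fin, Matrix.cons_val_zero,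
    Matrix.cons_val_one]
  have e₁ : (1 + (-1 + i)) * -1 * ((1 + (-1 - i)) * -1) = (1 : L) := by linear_combination -hi
  have e₂ : (-1 + i + 1) * (-1 : L) * ((-1 - i + 1) * (-1)) = 1 := by linear_combination -hi
  have e₃ : (1 + 1) * (-1 : L) = 1 := by linear_combination -h3L
  rw [e₁, e₃, one_pow, one_mul, one_pow, mul_one]
  have e₄ : ∀ x y z w s t : L, x * y * s ^ n * (z * w * t ^ n) = x * y * z * w * (s * t) ^ n := by
    intros
    ring
  rw [e₄, e₂, one_pow]
  linear_combination 16 * hi - 11 * h3L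

end JordanDet

/-! ### From transvections and determinants to the full linear group. -/

section Generation

open Matrix

/-- A submonoid containing all transvections contains all matrices of determinant one. -/
theorem Submonoid.mem_of_det_eq_one {ι F : Type*} [Fintype ι] [DecidableEq ι] [Field F]
    [Nontrivial ι] (S : Submonoid (Matrix ι ι F))
    (hS : ∀ i j : ι, i ≠ j → ∀ c : F, transvection i j c ∈ S) {A : Matrix ι ι F}
    (hA : A.det = 1) : A ∈ S := by
  refine SpecialLinearGroup.diagonal_transvection_induction'
    (P := fun B : SpecialLinearGroup ι F => (B : Matrix ι ι F) ∈ S) ⟨A, hA⟩ ?_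
    (fun i j hij c => hS i j hij c) fun B C hB hC => S.mul_mem hB hC
  intro i j hij c hc
  -- The classical factorisation into Weyl elements w(c)·w(-1), where w(c) is a product of three
  -- transvections.
  have h : diagonal (fun k => if k = i then c else if k = j then c⁻¹ else 1) =
      transvection i j c * transvection j i (-c⁻¹) * transvection i j c *
        (transvection i j (-1) * transvection j i 1 * transvection i j (-1)) := by
    have hd : diagonal (fun k => if k = i then c else if k = j then c⁻¹ else 1) =
        1 + ((c - 1) • single i i (1 : F) + (c⁻¹ - 1) • single j j (1 : F)) := by
      ext k l
      by_cases hkl : k = l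
      · subst hkl
        by_cases hk : k = i
        · subst hk
          simp [hij.symm]
        · by_cases hk' : k = j
          · subst hk'
            simp [hij, hk]
          · simp [hk, hk', Ne.symm hk, Ne.symm hk']
      · by_cases hk : k = i <;> by_cases hk' : k = j <;> simp_all
    have ht : ∀ (k l : ι) (x : F), transvection k l x = 1 + x • single k l (1 : F) :=
      fun k l x => by rw [transvection, smul_single, smul_eq_mul, mul_one]
    rw [hd]
    simp only [ht, mul_add, add_mul, mul_one, one_mul, smul_mul_assoc, mul_smul_comm,
      single_mul_single_same, single_mul_single_of_ne _ _ _ _ hij,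
      single_mul_single_of_ne _ _ _ _ hij.symm, smul_zero, add_zero]
    match_scalars <;> field_simp <;> ring
  change diagonal _ ∈ S
  rw [h]
  exact S.mul_mem (S.mul_mem (S.mul_mem (hS _ _ hij _) (hS _ _ hij.symm _)) (hS _ _ hij _))
    (S.mul_mem (S.mul_mem (hS _ _ hij _) (hS _ _ hij.symm _)) (hS _ _ hij _))

variable {K : Type*} [Field K] {n : ℕ}

theorem toLin_transvection (a b : Fin n × Fin n) (c : K) :
    Matrix.toLin (Matrix.stdBasis K (Fin n) (Fin n)) (Matrix.stdBasis K (Fin n) (Fin n))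
      (transvection a b c) = 1 + c • rankOne (single a.1 a.2 1) (coord b.1 b.2) := by
  refine (Matrix.stdBasis K (Fin n) (Fin n)).ext fun k => ?_
  rw [transvection, map_add, Matrix.toLin_one, LinearMap.add_apply, LinearMap.add_apply,
    Matrix.toLin_self]
  congr 1
  obtain ⟨k, l⟩ := k
  obtain ⟨i, j⟩ := a
  obtain ⟨r, s⟩ := b
  by_cases h : r = k ∧ s = l
  · obtain ⟨rfl, rfl⟩ := h
    simp [stdBasis_eq_single, single_apply, ite_smul]
  · have h' : ¬ (k = r ∧ l = s) := fun h' => h ⟨h'.1.symm, h'.2.symm⟩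
    simp [stdBasis_eq_single, h, h']

theorem mem_JMSMonoid_of_det_eq_one (h2 : ringChar K ≠ 2) (hn : 2 ≤ n)
    {x : Module.End K (Matrix (Fin n) (Fin n) K)} (hx : LinearMap.det x = 1) :
    x ∈ JMSMonoid K n h2 := by
  have : Nontrivial (Fin n) := Fin.nontrivial_iff_two_le.mpr hn
  let φ : Matrix (Fin n × Fin n) (Fin n × Fin n) K ≃ₐ[K]
      Module.End K (Matrix (Fin n) (Fin n) K) :=
    Matrix.toLinAlgEquiv (Matrix.stdBasis K (Fin n) (Fin n))
  obtain ⟨X, rfl⟩ := φ.surjective x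
  refine Submonoid.mem_of_det_eq_one ((JMSMonoid K n h2).comap φ) (fun a b hab c => ?_) ?_
  · change Matrix.toLin (Matrix.stdBasis K (Fin n) (Fin n)) (Matrix.stdBasis K (Fin n) (Fin n))
      (transvection a b c) ∈ JMSMonoid K n h2
    rw [toLin_transvection]
    exact containsTransvections_single h2 a b hab c
  · rw [← hx]
    exact (LinearMap.det_toLin (Matrix.stdBasis K (Fin n) (Fin n)) X).symm

theorem mem_jordanDet (h2 : ringChar K ≠ 2) (hn : 1 ≤ n) {d : K} (hd : d ≠ 0) :
    d ∈ jordanDet K n h2 := by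
  have h : (2 : K) ≠ 0 := Ring.two_ne_zero h2
  obtain ⟨m, rfl⟩ := Nat.exists_eq_add_of_le' hn
  by_cases hK : ∃ b : K, b ≠ 0 ∧ b ≠ 1 ∧ b ≠ -1
  · obtain ⟨b, hb, hb₁, hb₂⟩ := hK
    exact Submonoid.mem_of_prod_formula _ h m (prod_formula_mem_jordanDet h2) hb hb₁ hb₂ hd
  -- Now K = {0, 1, -1}; as 2 is neither 0 nor 1, it equals -1, so 3 = 0.
  · push Not at hK
    by_cases hd₁ : d = 1
    · exact hd₁ ▸ Submonoid.one_mem _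
    rw [hK d hd hd₁]
    obtain _ | m := m
    · simpa using prod_formula_mem_jordanDet (n := 0) h2 (-1 : K)
    · refine neg_one_mem_jordanDet h2 ?_
      have := hK 2 h fun h' => one_ne_zero (by linear_combination h' : (1 : K) = 0)
      linear_combination this

theorem mem_JMSMonoid_of_det_ne_zero (h2 : ringChar K ≠ 2) (hn : 1 ≤ n)
    {x : Module.End K (Matrix (Fin n) (Fin n) K)} (hx : LinearMap.det x ≠ 0) :
    x ∈ JMSMonoid K n h2 := by
  obtain ⟨y, hy, hyx⟩ := mem_jordanDet h2 hn hx
  obtain rfl | hn := hn.eq_or_lt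
  -- For n = 1 an operator is a scalar on a line, hence determined by its determinant.
  · suffices h : x = y from h ▸ hy
    have hdet : ∀ z : Module.End K (Matrix (Fin 1) (Fin 1) K),
        z = LinearMap.det z • LinearMap.id := fun z => by
      obtain ⟨c, rfl⟩ : ∃ c : K, z = c • LinearMap.id := by
        refine ⟨z 1 0 0, LinearMap.ext fun Z => ?_⟩
        have hZ : Z = Z 0 0 • (1 : Matrix (Fin 1) (Fin 1) K) := by
          ext i j
          fin_cases i; fin_cases j
          simp
        ext i j
        fin_cases i; fin_cases j
        rw [hZ]
        simp [mul_comm]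
      simp [Module.finrank_matrix]
    rw [hdet x, hdet y, hyx]
  · obtain ⟨y, rfl⟩ := LinearMap.isUnit_iff_isUnit_det y |>.mpr
      (isUnit_iff_ne_zero.mpr (by rw [hyx]; exact hx))
    rw [← y.mul_inv_cancel_left x]
    refine Submonoid.mul_mem _ hy (mem_JMSMonoid_of_det_eq_one h2 hn ?_)
    have h := congrArg LinearMap.det y.inv_mul
    rw [map_mul, hyx, map_one] at h
    rw [map_mul, h]

end Generation

theorem corollary4p15 (K : Type*) [Field K] (h2 : ringChar K ≠ 2) (n : ℕ) (hn : 1 ≤ n) :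
    JMSUnits K n h2 = (⊤ : Subgroup (LinearMap.GeneralLinearGroup K (Matrix (Fin n) (Fin n) K))) := by
  rw [eq_top_iff]
  intro x _
  have hmem : ∀ y : LinearMap.GeneralLinearGroup K (Matrix (Fin n) (Fin n) K),
      (y : Module.End K (Matrix (Fin n) (Fin n) K)) ∈ JMSMonoid K n h2 := fun y =>
    mem_JMSMonoid_of_det_ne_zero h2 hn (y.isUnit.map LinearMap.det).ne_zero
  exact ⟨⟨⟨x, hmem x⟩, ⟨↑x⁻¹, hmem x⁻¹⟩, Subtype.ext x.mul_inv, Subtype.ext x.inv_mul⟩,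
    Units.ext rfl⟩
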